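/- Let $(\tau,T,T')$ be random elements on a probability space, where $\tau$ takes values in an arbitrary measurable space and, given $\tau$, the real random variables $T$ and $T'$ are independent, each with the (regular) conditional law $\mathcal L(T\mid\tau)$. Let $V=V_\tau$ be a real-valued measurable function of $\tau$, and set $$W=V+T,\qquad W'=V+T'.$$ Suppose that $W$ and $W'$ have variance one and form an $a$-Stein pair for some $a\in(0,1]$, that is, $(W,W')$ is exchangeable and $E(W'\mid W)=(1-a)W$ almost surely. Let $$\mu_\tau=E(T\mid\tau),\qquad \sigma_\tau^2=E\big((T-\mu_\tau)^2\mid\tau\big)$$ denote the mean and variance of $\mathcal L(T\mid\tau)$, let $F$ be the distribution of $\tau$, and let $Z$ be a standard normal random variable. For real random variables $X,Y$ let $$\|\mathcal L(X)-\mathcal L(Y)\|_1=\int_{-\infty}^\infty |P(X\le x)-P(Y\le x)|\,dx$$ be the $L^1$ (Wasserstein) distance between their laws. Then: 1. The measure $F^\Box$ given by $dF^\Box(\tau)=\dfrac{\sigma_\tau^2}{a}\,dF(\tau)$ is a probability measure. 2. For any coupling of $\tau$ with a random element $\tau^\Box$ having distribution $F^\Box$, $$\|\mathcal L(W)-\mathcal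 L(Z)\|_1\le 2E\big|(V_{\tau^\Box}-V_\tau)+(\mu_{\tau^\Box}-\mu_\tau)\big|+2E|T-\mu_\tau|+\frac{E|T-\mu_\tau|^3}{\mathrm{Var}(T-\mu_\tau)}.$$ 3. If $\mu_\tau=0$ almost surely and $\sigma_\tau^2$ is almost surely constant, then $$\|\mathcal L(W)-\mathcal L(Z)\|_1\le 2E|T|+\frac{E|T|^3}{\mathrm{Var}(T)}.$$ The right-hand sides are allowed to be $+\infty$. -/

import Mathlib

open MeasureTheory ProbabilityTheory
open scoped ENNReal

noncomputable section

/-- `(W, W')` is an `a`-Stein pair: an exchangeable pair of integrable random variables with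
`E(W' | W) = (1 - a) W` almost surely, where `0 < a ≤ 1`. -/
structure IsSteinPair {Ω : Type*} [mΩ : MeasurableSpace Ω] (P : Measure Ω) (W W' : Ω → ℝ) (a : ℝ) :
    Prop where
  pos : 0 < a
  le_one : a ≤ 1
  measurable_left : Measurable W
  measurable_right : Measurable W'
  integrable_left : Integrable W P
  integrable_right : Integrable W' P
  exchangeable : P.map (fun ω => (W ω, W' ω)) = P.map (fun ω => (W' ω, W ω))
  regression : P[W' | MeasurableSpace.comap W inferInstance] =ᵐ[P] fun ω => (1 - a) * W ω

/-- `T` and `T'` are sampled independently from the conditional law of `T` given `τ`: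
the joint law of `(τ, T, T')` is `L(τ)(dx) L(T | τ = x)(dt) L(T | τ = x)(dt')`. -/
def IsCondIIDCopy {Ω 𝒳 : Type*} [MeasurableSpace Ω] [MeasurableSpace 𝒳] (P : Measure Ω)
    [IsFiniteMeasure P] (τ : Ω → 𝒳) (T T' : Ω → ℝ) : Prop :=
  P.map (fun ω => (τ ω, T ω, T' ω)) =
    (P.map τ) ⊗ₘ ((condDistrib T τ P) ×ₖ (condDistrib T τ P))

/-- The conditional mean `x ↦ E(T | τ = x)`, as the mean of the conditional law of `T`. -/
def condMeanAt {Ω 𝒳 : Type*} [MeasurableSpace Ω] [MeasurableSpace 𝒳] (P : Measure Ω)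
    [IsFiniteMeasure P] (τ : Ω → 𝒳) (T : Ω → ℝ) (x : 𝒳) : ℝ :=
  ∫ t, t ∂(condDistrib T τ P x)

/-- The conditional variance `x ↦ E((T - E(T | τ))² | τ = x)`. -/
def condVarAt {Ω 𝒳 : Type*} [MeasurableSpace Ω] [MeasurableSpace 𝒳] (P : Measure Ω)
    [IsFiniteMeasure P] (τ : Ω → 𝒳) (T : Ω → ℝ) (x : 𝒳) : ℝ :=
  ∫ t, (t - condMeanAt P τ T x) ^ 2 ∂(condDistrib T τ P x)

/-- The law of `τ` reweighted by the density `σ_τ² / a`. -/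
def boxLaw {Ω 𝒳 : Type*} [MeasurableSpace Ω] [MeasurableSpace 𝒳] (P : Measure Ω)
    [IsFiniteMeasure P] (τ : Ω → 𝒳) (T : Ω → ℝ) (a : ℝ) : Measure 𝒳 :=
  (P.map τ).withDensity (fun x => ENNReal.ofReal (condVarAt P τ T x / a))

/-- `π` is a coupling of `α` and `β`: the joint law of a pair of random objects, the first with
law `α` and the second with law `β`. -/
structure IsCouplingOf {𝒳 : Type*} [MeasurableSpace 𝒳] (π : Measure (𝒳 × 𝒳)) (α β : Measure 𝒳) :
    Prop where
  fst_eq : π.fst = α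
  snd_eq : π.snd = β

/-- The `L¹` metric between probability laws on `ℝ`: the `L¹` distance `∫ |F - G| dx` of their
distribution functions. -/
def l1Dist (α β : Measure ℝ) : ℝ≥0∞ :=
  ∫⁻ x, ENNReal.ofReal |cdf α x - cdf β x|

end

/-! The proof is Stein's method. Write `Y = T - μ_τ` and `M = V + μ_τ`, so that `W = M(τ) + Y`,
where `Y` has conditional mean zero given `τ`. By duality the `L¹` distance is controlled by `E h(W)
- E h(Z)` over bounded 1-Lipschitz `h`. For each such `h` the Stein equation `f'(w) - w f(w) = h(w)
- E h(Z)` has a solution with `|f| ≤ 1` and `f'` 2-Lipschitz (`exists_stein_solution`), so it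
remains to bound `E f'(W) - E f(W) W`.

The regression property gives `a E f(W) W = E f(W)(W - W') = E f(W)(T - T')`. Given `τ`, `T'` is
independent of `W` with mean `μ_τ`, so this equals `E f(W) Y` (`IsSteinPair.mul_integral_mul_eq`).
Taking `f` to be the identity yields `a = E Y²`, which makes `F^□` a probability measure and `Var(Y)
= a`. Since `E f(M) Y = 0`, Taylor expansion at `M` turns `E f(W) Y / a` into `E (Y²/a) f'(M)` with
error at most `E|Y|³ / a`, and the weighted expectation is exactly `E f'(M(τ^□))`. Because `f'` is
2-Lipschitz, passing from `M(τ^□)` to `M(τ)` costs `2 E|M(τ^□) - M(τ)|`, and from `M(τ)` to `W`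
costs `2 E|Y|`. If the conditional variance is constant then `F^□ = F`, and the diagonal coupling
removes the first term. -/

/-! ### Gaussian integrals and the Mills ratio -/

open Set Filter Topology in
theorem tendsto_exp_neg_sq_div_two_atTop :
    Tendsto (fun t : ℝ => Real.exp (-t ^ 2 / 2)) atTop (𝓝 0) := by
  refine Real.tendsto_exp_atBot.comp ?_
  have : Tendsto (fun t : ℝ => t ^ 2 / 2) atTop atTop :=
    (tendsto_pow_atTop two_ne_zero).atTop_div_const two_pos
  refine (tendsto_neg_atTop_atBot.comp this).congr fun t => ?_
  simp [neg_div]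

theorem integrable_exp_neg_sq_div_two : Integrable (fun t : ℝ => Real.exp (-t ^ 2 / 2)) := by
  have := integrable_exp_neg_mul_sq (b := 1 / 2) (by norm_num)
  refine this.congr (.of_forall fun t => ?_)
  simp only []
  congr 1
  ring

theorem integrable_id_mul_exp_neg_sq_div_two :
    Integrable (fun t : ℝ => t * Real.exp (-t ^ 2 / 2)) := by
  have := integrable_mul_exp_neg_mul_sq (b := 1 / 2) (by norm_num)
  refine this.congr (.of_forall fun t => ?_)
  simp only []
  congr 2
  ring

theorem hasDerivAt_exp_neg_sq_div_two (t : ℝ) :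
    HasDerivAt (fun t : ℝ => Real.exp (-t ^ 2 / 2)) (-t * Real.exp (-t ^ 2 / 2)) t := by
  have h : HasDerivAt (fun t : ℝ => -t ^ 2 / 2) (-(2 * t) / 2) t := by
    simpa using ((hasDerivAt_pow 2 t).fun_neg).div_const 2
  refine h.exp.congr_deriv ?_
  ring

theorem integral_Ioi_exp_neg_sq_div_two_eq (w : ℝ) :
    ∫ t in Set.Ioi w, Real.exp (-t ^ 2 / 2) = ∫ t in Set.Iic (-w), Real.exp (-t ^ 2 / 2) := by
  rw [← integral_comp_neg_Ioi]
  simp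

/-- Lower bound for the Mills ratio of the Gaussian tail. -/
theorem le_integral_Ioi_exp_neg_sq_div_two (w : ℝ) :
    w * Real.exp (-w ^ 2 / 2) ≤ (1 + w ^ 2) * ∫ t in Set.Ioi w, Real.exp (-t ^ 2 / 2) := by
  -- The boundary value of this primitive at `w` is the bound sought, up to the factor `1 + w ^ 2`;
  -- its derivative lies below the Gaussian weight because the subtracted fraction is nonnegative.
  have hd : ∀ t : ℝ, HasDerivAt (fun t : ℝ => -(t / (1 + t ^ 2)) * Real.exp (-t ^ 2 / 2))
      ((1 - 2 / (1 + t ^ 2) ^ 2) * Real.exp (-t ^ 2 / 2)) t := by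
    intro t
    have hp : (1 + t ^ 2) ≠ 0 := by positivity
    have h1 := (((hasDerivAt_id t).div ((hasDerivAt_pow 2 t).const_add 1) hp).neg).mul
      (hasDerivAt_exp_neg_sq_div_two t)
    refine h1.congr_deriv ?_
    simp
    field_simp
    ring
  have hi : Integrable (fun t : ℝ => (1 - 2 / (1 + t ^ 2) ^ 2) * Real.exp (-t ^ 2 / 2)) := by
    refine integrable_exp_neg_sq_div_two.bdd_mul (c := 3) (Measurable.aestronglyMeasurable (by fun_prop))
      (.of_forall fun t => ?_)
    have h1 : 1 ≤ (1 + t ^ 2) ^ 2 := by nlinarith [sq_nonneg t]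
    have h2 : 2 / (1 + t ^ 2) ^ 2 ≤ 2 := div_le_self (by norm_num) h1
    have h3 : 0 ≤ 2 / (1 + t ^ 2) ^ 2 := by positivity
    rw [Real.norm_eq_abs, abs_le]
    constructor <;> linarith
  have ht : Filter.Tendsto (fun t : ℝ => -(t / (1 + t ^ 2)) * Real.exp (-t ^ 2 / 2))
      Filter.atTop (nhds 0) := by
    refine squeeze_zero_norm (fun t => ?_) tendsto_exp_neg_sq_div_two_atTop
    rw [norm_mul, norm_neg, Real.norm_of_nonneg (Real.exp_pos _).le]
    refine mul_le_of_le_one_left (Real.exp_pos _).le ?_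
    rw [Real.norm_eq_abs, abs_div, abs_of_pos (a := 1 + t ^ 2) (by positivity),
      div_le_one (by positivity)]
    nlinarith [sq_nonneg (|t| - 1), sq_abs t, abs_nonneg t]
  have h := integral_Ioi_of_hasDerivAt_of_tendsto' (fun t _ => hd t) hi.integrableOn ht (a := w)
  have hle : ∫ t in Set.Ioi w, (1 - 2 / (1 + t ^ 2) ^ 2) * Real.exp (-t ^ 2 / 2) ≤
      ∫ t in Set.Ioi w, Real.exp (-t ^ 2 / 2) := by
    refine integral_mono hi.integrableOn integrable_exp_neg_sq_div_two.integrableOn fun t => ?_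
    refine mul_le_of_le_one_left (Real.exp_pos _).le ?_
    have : 0 ≤ 2 / (1 + t ^ 2) ^ 2 := by positivity
    linarith
  rw [h] at hle
  have hp : 0 < 1 + w ^ 2 := by positivity
  have := mul_le_mul_of_nonneg_left hle hp.le
  refine le_trans (le_of_eq ?_) this
  field_simp
  ring

theorem le_integral_Iic_exp_neg_sq_div_two (w : ℝ) :
    -w * Real.exp (-w ^ 2 / 2) ≤ (1 + w ^ 2) * ∫ t in Set.Iic w, Real.exp (-t ^ 2 / 2) := by
  simpa [integral_Ioi_exp_neg_sq_div_two_eq] using le_integral_Ioi_exp_neg_sq_div_two (-w)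

/-! ### Solutions of the Stein equation -/

/-- The solution `f` of the Stein equation `f' w - w * f w = k w`, for `k` of Gaussian mean zero. -/
noncomputable def steinSol (k : ℝ → ℝ) (w : ℝ) : ℝ :=
  Real.exp (w ^ 2 / 2) * ∫ t in Set.Iic w, k t * Real.exp (-t ^ 2 / 2)

theorem exp_sq_mul_exp_neg_sq (w : ℝ) : Real.exp (w ^ 2 / 2) * Real.exp (-w ^ 2 / 2) = 1 := by
  rw [← Real.exp_add, neg_div, add_neg_cancel, Real.exp_zero]

theorem hasDerivAt_steinSol {k : ℝ → ℝ} (hk : Continuous k)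
    (hi : Integrable fun t => k t * Real.exp (-t ^ 2 / 2)) (w : ℝ) :
    HasDerivAt (steinSol k) (w * steinSol k w + k w) w := by
  have hc : Continuous fun t => k t * Real.exp (-t ^ 2 / 2) := by fun_prop
  have h1 : HasDerivAt (fun w => ∫ t in Set.Iic w, k t * Real.exp (-t ^ 2 / 2))
      (k w * Real.exp (-w ^ 2 / 2)) w := by
    have h2 : (fun w => ∫ t in Set.Iic w, k t * Real.exp (-t ^ 2 / 2)) = fun w =>
        (∫ t in Set.Iic 0, k t * Real.exp (-t ^ 2 / 2)) +
          ∫ t in (0 : ℝ)..w, k t * Real.exp (-t ^ 2 / 2) := by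
      funext w
      rw [← intervalIntegral.integral_Iic_sub_Iic hi.integrableOn hi.integrableOn]
      ring
    rw [h2]
    exact (intervalIntegral.integral_hasDerivAt_right (hc.intervalIntegrable _ _)
      (hc.stronglyMeasurableAtFilter _ _) hc.continuousAt).const_add _
  have h3 := (((hasDerivAt_pow 2 w).div_const 2).exp).mul h1
  refine h3.congr_deriv ?_
  have h4 := exp_sq_mul_exp_neg_sq w
  simp only [steinSol]
  push_cast
  linear_combination k w * h4

theorem steinSol_add {k l : ℝ → ℝ} (hk : Integrable fun t => k t * Real.exp (-t ^ 2 / 2))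
    (hl : Integrable fun t => l t * Real.exp (-t ^ 2 / 2)) (w : ℝ) :
    steinSol (fun t => k t + l t) w = steinSol k w + steinSol l w := by
  simp only [steinSol, add_mul]
  rw [integral_add hk.integrableOn hl.integrableOn, mul_add]

theorem steinSol_neg (k : ℝ → ℝ) (w : ℝ) : steinSol (fun t => -k t) w = -steinSol k w := by
  simp [steinSol, integral_neg]

theorem steinSol_id (w : ℝ) : steinSol (fun t => t) w = -1 := by
  have h : ∫ t in Set.Iic w, t * Real.exp (-t ^ 2 / 2) = -Real.exp (-w ^ 2 / 2) - 0 := by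
    refine integral_Iic_of_hasDerivAt_of_tendsto' (f := fun t => -Real.exp (-t ^ 2 / 2))
      (fun t _ => ?_) integrable_id_mul_exp_neg_sq_div_two.integrableOn ?_
    · simpa using (hasDerivAt_exp_neg_sq_div_two t).fun_neg
    · have := (tendsto_exp_neg_sq_div_two_atTop.comp Filter.tendsto_neg_atBot_atTop).neg
      simpa [Function.comp_def] using this
  rw [steinSol, h]
  linear_combination -exp_sq_mul_exp_neg_sq w

/-- The second expression is the derivative of `w * steinSol k w`. Monotonicity bounds the integral
of `k` over either tail by `k w` times its Gaussian mass, and mean zero makes both tails available;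
the Mills ratio bound then gives the sign. -/
theorem steinSol_monotone_bounds {k : ℝ → ℝ} (hk : Monotone k)
    (hi : Integrable fun t => k t * Real.exp (-t ^ 2 / 2))
    (h0 : ∫ t, k t * Real.exp (-t ^ 2 / 2) = 0) (w : ℝ) :
    steinSol k w ≤ 0 ∧ (1 + w ^ 2) * steinSol k w + w * k w ≤ 0 := by
  have hE := exp_sq_mul_exp_neg_sq w
  have hEpos := Real.exp_pos (w ^ 2 / 2)
  have hn1 : 0 ≤ ∫ t in Set.Iic w, Real.exp (-t ^ 2 / 2) :=
    integral_nonneg fun t => (Real.exp_pos _).le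
  have hn2 : 0 ≤ ∫ t in Set.Ioi w, Real.exp (-t ^ 2 / 2) :=
    integral_nonneg fun t => (Real.exp_pos _).le
  have hs : (∫ t in Set.Iic w, k t * Real.exp (-t ^ 2 / 2)) =
      -∫ t in Set.Ioi w, k t * Real.exp (-t ^ 2 / 2) := by
    have := integral_add_compl (measurableSet_Iic (a := w)) hi
    rw [h0, Set.compl_Iic] at this
    linarith
  have hI : ∫ t in Set.Iic w, k t * Real.exp (-t ^ 2 / 2) ≤
      k w * ∫ t in Set.Iic w, Real.exp (-t ^ 2 / 2) := by
    rw [← integral_const_mul]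
    refine setIntegral_mono_on hi.integrableOn
      (integrable_exp_neg_sq_div_two.const_mul _).integrableOn measurableSet_Iic fun t ht => ?_
    exact mul_le_mul_of_nonneg_right (hk ht) (Real.exp_pos _).le
  have hJ : ∫ t in Set.Iic w, k t * Real.exp (-t ^ 2 / 2) ≤
      -(k w * ∫ t in Set.Ioi w, Real.exp (-t ^ 2 / 2)) := by
    rw [hs, ← integral_const_mul]
    refine neg_le_neg (setIntegral_mono_on (integrable_exp_neg_sq_div_two.const_mul _).integrableOn
      hi.integrableOn measurableSet_Ioi fun t ht => ?_)
    exact mul_le_mul_of_nonneg_right (hk (le_of_lt ht)) (Real.exp_pos _).le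
  have key : ∀ J : ℝ, steinSol k w ≤ Real.exp (w ^ 2 / 2) * J →
      (1 + w ^ 2) * J + w * k w * Real.exp (-w ^ 2 / 2) ≤ 0 →
      (1 + w ^ 2) * steinSol k w + w * k w ≤ 0 := by
    intro J h1 h2
    have h3 := mul_le_mul_of_nonneg_left h1 (by positivity : 0 ≤ 1 + w ^ 2)
    have h4 := mul_nonpos_of_nonneg_of_nonpos hEpos.le h2
    have h5 : Real.exp (w ^ 2 / 2) * ((1 + w ^ 2) * J + w * k w * Real.exp (-w ^ 2 / 2)) =
      (1 + w ^ 2) * (Real.exp (w ^ 2 / 2) * J) + w * k w := by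
      linear_combination w * k w * hE
    linarith
  -- The sign of `k w` decides which tail is useful: the left one when `k w ≤ 0`, the right one
  -- otherwise.
  rcases le_total (k w) 0 with h | h
  · have hf := mul_le_mul_of_nonneg_left hI hEpos.le
    refine ⟨hf.trans ?_, key _ hf ?_⟩
    · exact mul_nonpos_of_nonneg_of_nonpos hEpos.le (mul_nonpos_of_nonpos_of_nonneg h hn1)
    · have := mul_le_mul_of_nonpos_left (le_integral_Iic_exp_neg_sq_div_two w) h
      linarith
  · have hf := mul_le_mul_of_nonneg_left hJ hEpos.le
    refine ⟨hf.trans ?_, key _ hf ?_⟩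
    · exact mul_nonpos_of_nonneg_of_nonpos hEpos.le (neg_nonpos.2 (mul_nonneg h hn2))
    · have := mul_le_mul_of_nonneg_left (le_integral_Ioi_exp_neg_sq_div_two w) h
      linarith

theorem antitone_mul_steinSol {k : ℝ → ℝ} (hk : Monotone k) (hc : Continuous k)
    (hi : Integrable fun t => k t * Real.exp (-t ^ 2 / 2))
    (h0 : ∫ t, k t * Real.exp (-t ^ 2 / 2) = 0) : Antitone fun w => w * steinSol k w := by
  have hd : ∀ w, HasDerivAt (fun w => w * steinSol k w)
      (1 * steinSol k w + w * (w * steinSol k w + k w)) w := fun w =>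
    (hasDerivAt_id w).mul (hasDerivAt_steinSol hc hi w)
  refine antitone_of_deriv_nonpos (fun w => (hd w).differentiableAt) fun w => ?_
  rw [(hd w).deriv]
  linarith [(steinSol_monotone_bounds hk hi h0 w).2]

/-- If `k` is 1-Lipschitz, both `k + id` and `-k + id` are monotone, and the identity contributes
only the constant solution `-1`. The monotone bounds for both give `|steinSol k| ≤ 1` and show that
`w * steinSol k w` is 1-Lipschitz; adding `k` gives the constant 2. -/
theorem steinSol_lipschitz_bounds {k : ℝ → ℝ} (hk : ∀ x y, |k x - k y| ≤ |x - y|)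
    (hi : Integrable fun t => k t * Real.exp (-t ^ 2 / 2))
    (h0 : ∫ t, k t * Real.exp (-t ^ 2 / 2) = 0) :
    (∀ w, |steinSol k w| ≤ 1) ∧
      ∀ w v, |(w * steinSol k w + k w) - (v * steinSol k v + k v)| ≤ 2 * |w - v| := by
  have hc : Continuous k := by
    refine (LipschitzWith.of_dist_le_mul (K := 1) fun x y => ?_).continuous
    simpa [Real.dist_eq] using hk x y
  have hid := integrable_id_mul_exp_neg_sq_div_two
  have hid0 : ∫ t : ℝ, t * Real.exp (-t ^ 2 / 2) = 0 := by
    have := integral_neg_eq_self (fun t : ℝ => t * Real.exp (-t ^ 2 / 2)) volume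
    simp only [neg_mul, even_two, Even.neg_pow, integral_neg] at this
    linarith
  have aux : ∀ l : ℝ → ℝ, (∀ x y, |l x - l y| ≤ |x - y|) → Continuous l →
      Integrable (fun t => l t * Real.exp (-t ^ 2 / 2)) →
      ∫ t, l t * Real.exp (-t ^ 2 / 2) = 0 →
      (∀ w, steinSol l w ≤ 1) ∧
        ∀ w v, w ≤ v → v * steinSol l v - w * steinSol l w ≤ v - w := by
    intro l hl hlc hli hl0
    have hm : Monotone fun t => l t + t := by
      intro x y hxy
      have h1 := hl x y
      rw [abs_sub_comm x y, abs_of_nonneg (sub_nonneg.2 hxy)] at h1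
      have := (abs_le.1 h1).2
      simp only []
      linarith
    have hmi : Integrable fun t => (l t + t) * Real.exp (-t ^ 2 / 2) := by
      simp only [add_mul]
      exact hli.add hid
    have hm0 : ∫ t, (l t + t) * Real.exp (-t ^ 2 / 2) = 0 := by
      simp only [add_mul]
      rw [integral_add hli hid, hl0, hid0, add_zero]
    have hs : ∀ w, steinSol (fun t => l t + t) w = steinSol l w - 1 := fun w => by
      rw [steinSol_add hli hid, steinSol_id, sub_eq_add_neg]
    refine ⟨fun w => ?_, fun w v hwv => ?_⟩
    · have := (steinSol_monotone_bounds hm hmi hm0 w).1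
      rw [hs] at this
      linarith
    · have := antitone_mul_steinSol hm (by fun_prop) hmi hm0 hwv
      simp only [hs] at this
      linarith
  obtain ⟨b1, l1⟩ := aux k hk hc hi h0
  obtain ⟨b2, l2⟩ := aux (fun t => -k t)
    (fun x y => by rw [neg_sub_neg, abs_sub_comm]; exact hk x y) hc.neg
    (by simp only [neg_mul]; exact hi.neg) (by simp [integral_neg, h0])
  simp only [steinSol_neg] at b2 l2
  refine ⟨fun w => abs_le.2 ⟨by linarith [b2 w], b1 w⟩, ?_⟩
  have main : ∀ w v, w ≤ v →
      |(w * steinSol k w + k w) - (v * steinSol k v + k v)| ≤ 2 * |w - v| := by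
    intro w v h
    have h1 := l1 w v h
    have h2 := l2 w v h
    have h3 := abs_le.1 (hk w v)
    have h4 : |w - v| = v - w := by rw [abs_sub_comm, abs_of_nonneg (sub_nonneg.2 h)]
    rw [h4] at h3 ⊢
    rw [abs_le]
    constructor <;> linarith [h3.1, h3.2]
  intro w v
  rcases le_total w v with h | h
  · exact main w v h
  · rw [abs_sub_comm, abs_sub_comm w v]
    exact main v w h

/-- Taylor's formula with integral remainder: the increment of `g` is at most `2 * s * |y|`, and `∫
2 s ds = 1` on the unit interval. -/
theorem abs_sub_sub_mul_le_of_lipschitz_deriv {f g : ℝ → ℝ} (hf : ∀ x, HasDerivAt f (g x) x)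
    (hg : ∀ x y, |g x - g y| ≤ 2 * |x - y|) (x y : ℝ) :
    |f (x + y) - f x - y * g x| ≤ y ^ 2 := by
  have hgc : Continuous g := by
    refine (LipschitzWith.of_dist_le_mul (K := 2) fun x y => ?_).continuous
    simpa [Real.dist_eq] using hg x y
  have h1 : ∫ s in (0 : ℝ)..1, y * (g (x + s * y) - g x) = f (x + y) - f x - y * g x := by
    have h2 : ∀ s ∈ Set.uIcc (0 : ℝ) 1, HasDerivAt (fun s => f (x + s * y) - s * (y * g x))
        (y * (g (x + s * y) - g x)) s := by
      intro s _
      have h3 : HasDerivAt (fun s => x + s * y) (1 * y) s :=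
        ((hasDerivAt_id s).mul_const y).const_add x
      have h4 := ((hf (x + s * y)).comp s h3).sub ((hasDerivAt_id s).mul_const (y * g x))
      refine h4.congr_deriv ?_
      ring
    rw [intervalIntegral.integral_eq_sub_of_hasDerivAt h2
      ((by fun_prop : Continuous _).intervalIntegrable _ _)]
    simp
    ring
  rw [← h1, ← Real.norm_eq_abs]
  have h5 : ∫ s in (0 : ℝ)..1, 2 * y ^ 2 * s = y ^ 2 := by
    rw [intervalIntegral.integral_const_mul, integral_id]
    ring
  rw [← h5]
  refine intervalIntegral.norm_integral_le_of_norm_le zero_le_one (.of_forall fun s hs => ?_)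
    ((by fun_prop : Continuous _).intervalIntegrable _ _)
  have h6 := hg (x + s * y) x
  rw [add_sub_cancel_left, abs_mul, abs_of_pos hs.1] at h6
  rw [norm_mul, Real.norm_eq_abs, Real.norm_eq_abs]
  calc |y| * |g (x + s * y) - g x| ≤ |y| * (2 * (s * |y|)) :=
        mul_le_mul_of_nonneg_left h6 (abs_nonneg y)
    _ = 2 * |y| ^ 2 * s := by ring
    _ = 2 * y ^ 2 * s := by rw [sq_abs]

/-- Solvability of Stein's equation for bounded Lipschitz test functions. -/
theorem exists_stein_solution {h : ℝ → ℝ} (hh : ∀ x y, |h x - h y| ≤ |x - y|) {B : ℝ}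
    (hB : ∀ x, |h x| ≤ B) :
    ∃ f g : ℝ → ℝ, (∀ x, HasDerivAt f (g x) x) ∧ (∀ x, |f x| ≤ 1) ∧
      (∀ x y, |g x - g y| ≤ 2 * |x - y|) ∧
      ∀ x, g x = x * f x + (h x - ∫ z, h z ∂(gaussianReal 0 1)) := by
  set c := ∫ z, h z ∂(gaussianReal 0 1) with hcdef
  have hlip : ∀ x y, |(h x - c) - (h y - c)| ≤ |x - y| := fun x y => by simpa using hh x y
  have hc : Continuous h := by
    refine (LipschitzWith.of_dist_le_mul (K := 1) fun x y => ?_).continuous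
    simpa [Real.dist_eq] using hh x y
  have hi1 : Integrable fun t => h t * Real.exp (-t ^ 2 / 2) :=
    integrable_exp_neg_sq_div_two.bdd_mul (c := B) hc.aestronglyMeasurable
      (.of_forall fun t => hB t)
  have hi2 : Integrable fun t => c * Real.exp (-t ^ 2 / 2) :=
    integrable_exp_neg_sq_div_two.const_mul c
  have hi : Integrable fun t => (h t - c) * Real.exp (-t ^ 2 / 2) := by
    simp only [sub_mul]
    exact hi1.sub hi2
  have hpdf : ∀ t, gaussianPDFReal 0 1 t = (√(2 * Real.pi))⁻¹ * Real.exp (-t ^ 2 / 2) := by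
    intro t
    simp [gaussianPDFReal]
  have hgauss : ∀ u : ℝ → ℝ, ∫ z, u z ∂(gaussianReal 0 1) =
      (√(2 * Real.pi))⁻¹ * ∫ t, u t * Real.exp (-t ^ 2 / 2) := by
    intro u
    rw [integral_gaussianReal_eq_integral_smul one_ne_zero, ← integral_const_mul]
    refine integral_congr_ae (.of_forall fun t => ?_)
    simp only [hpdf, smul_eq_mul]
    ring
  have h0 : ∫ t, (h t - c) * Real.exp (-t ^ 2 / 2) = 0 := by
    have h1 := hgauss (fun z => h z - c)
    have hint : Integrable h (gaussianReal 0 1) :=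
      Integrable.of_bound hc.aestronglyMeasurable B (.of_forall fun t => hB t)
    rw [integral_sub hint (integrable_const c), ← hcdef] at h1
    simp only [integral_const, probReal_univ, smul_eq_mul, one_mul, sub_self] at h1
    rcases mul_eq_zero.1 h1.symm with h2 | h2
    · have : 0 < √(2 * Real.pi) := Real.sqrt_pos.2 (by positivity)
      exact absurd h2 (inv_pos.2 this).ne'
    · exact h2
  obtain ⟨hb, hl⟩ := steinSol_lipschitz_bounds hlip hi h0
  exact ⟨steinSol fun t => h t - c, _, fun x => hasDerivAt_steinSol (by fun_prop) hi x, hb, hl,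
    fun x => rfl⟩

/-! ### Duality between the `L¹` distance and Lipschitz test functions -/

theorem integral_integral_Iio_eq (α : Measure ℝ) [IsProbabilityMeasure α] {s : ℝ → ℝ}
    (hs : Integrable s) :
    ∫ x, (∫ u in Set.Iio x, s u) ∂α = ∫ u, s u * (1 - cdf α u) := by
  have hm : MeasurableSet {p : ℝ × ℝ | p.2 < p.1} := measurableSet_lt measurable_snd measurable_fst
  have hint : Integrable (Function.uncurry fun x u => (Set.Iio x).indicator s u)
      (α.prod volume) :=
    (hs.comp_snd α).indicator hm
  calc ∫ x, (∫ u in Set.Iio x, s u) ∂α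
      = ∫ x, (∫ u, (Set.Iio x).indicator s u) ∂α := by
        simp only [integral_indicator measurableSet_Iio]
    _ = ∫ u, (∫ x, (Set.Iio x).indicator s u ∂α) := integral_integral_swap hint
    _ = ∫ u, s u * (1 - cdf α u) := by
        refine integral_congr_ae (.of_forall fun u => ?_)
        have h1 : ∀ x, (Set.Iio x).indicator s u = (Set.Ioi u).indicator (fun _ => s u) x :=
          fun x => rfl
        simp only [h1]
        rw [integral_indicator_const _ measurableSet_Ioi, ← Set.compl_Iic,
          probReal_compl_eq_one_sub measurableSet_Iic, cdf_eq_real, smul_eq_mul, mul_comm]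

/-- The extremal test function is the primitive of the sign of the difference of the distribution
functions. Truncating the sign to `[-n, n]` makes the primitive bounded, and by Fubini it recovers
the distance over that interval; then `n → ∞`. -/
theorem l1Dist_le_of_forall_lipschitz (α γ : Measure ℝ) [IsProbabilityMeasure α]
    [IsProbabilityMeasure γ] {C : ℝ≥0∞}
    (hC : ∀ (h : ℝ → ℝ) (B : ℝ), (∀ x y, |h x - h y| ≤ |x - y|) → (∀ x, |h x| ≤ B) →
      ENNReal.ofReal (∫ x, h x ∂α - ∫ x, h x ∂γ) ≤ C) :
    l1Dist α γ ≤ C := by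
  have hma : Measurable (cdf α) := (monotone_cdf α).measurable
  have hmg : Measurable (cdf γ) := (monotone_cdf γ).measurable
  set s : ℝ → ℝ := fun u => if cdf α u ≤ cdf γ u then 1 else -1 with hsdef
  have hsm : Measurable s :=
    Measurable.ite (measurableSet_le hma hmg) measurable_const measurable_const
  have hs1 : ∀ u, |s u| ≤ 1 := fun u => by
    simp only [hsdef]
    split_ifs <;> simp
  have hsabs : ∀ u, s u * (cdf γ u - cdf α u) = |cdf α u - cdf γ u| := fun u => by
    simp only [hsdef]
    split_ifs with h
    · rw [abs_of_nonpos (by linarith)]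
      ring
    · rw [abs_of_nonneg (by linarith)]
      ring
  have hcdf : ∀ (β : Measure ℝ) [IsProbabilityMeasure β] (u : ℝ), |1 - cdf β u| ≤ 1 :=
    fun β _ u => abs_le.2 ⟨by linarith [cdf_le_one β u], by linarith [cdf_nonneg β u]⟩
  have hfin : ∀ n : ℕ, ∫⁻ x in Set.Icc (-(n : ℝ)) n, ENNReal.ofReal |cdf α x - cdf γ x| ≤ C := by
    intro n
    set r : ℝ → ℝ := (Set.Icc (-(n : ℝ)) n).indicator s with hr
    have hr1 : ∀ u, |r u| ≤ 1 := fun u => by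
      by_cases hu : u ∈ Set.Icc (-(n : ℝ)) n
      · simpa [hr, hu] using hs1 u
      · simp [hr, hu]
    have hsi : IntegrableOn s (Set.Icc (-(n : ℝ)) n) :=
      Measure.integrableOn_of_bounded (by simp) hsm.aestronglyMeasurable (M := 1)
        (.of_forall hs1)
    have hri : Integrable r := hsi.integrable_indicator measurableSet_Icc
    have hlip : ∀ x y, |(∫ u in Set.Iio x, r u) - ∫ u in Set.Iio y, r u| ≤ |x - y| := by
      intro x y
      rw [← integral_Iic_eq_integral_Iio, ← integral_Iic_eq_integral_Iio,
        intervalIntegral.integral_Iic_sub_Iic hri.integrableOn hri.integrableOn]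
      simpa using intervalIntegral.norm_integral_le_of_norm_le_const (C := 1) (a := y) (b := x)
        (f := r) fun u _ => hr1 u
    have hbd : ∀ x, |∫ u in Set.Iio x, r u| ≤ ∫ u, |r u| := fun x =>
      (norm_integral_le_integral_norm _).trans
        (setIntegral_le_integral hri.norm (.of_forall fun u => norm_nonneg _))
    refine le_trans (le_of_eq ?_) (hC _ _ hlip hbd)
    have hmul : ∀ (β : Measure ℝ) [IsProbabilityMeasure β],
        Integrable fun u => r u * (1 - cdf β u) := fun β _ =>
      hri.mul_bdd (c := 1) ((monotone_cdf β).measurable.const_sub 1).aestronglyMeasurable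
        (.of_forall (hcdf β))
    rw [integral_integral_Iio_eq α hri, integral_integral_Iio_eq γ hri,
      ← integral_sub (hmul α) (hmul γ)]
    have hrabs : ∀ u, r u * (1 - cdf α u) - r u * (1 - cdf γ u) =
        (Set.Icc (-(n : ℝ)) n).indicator (fun u => |cdf α u - cdf γ u|) u := by
      intro u
      by_cases hu : u ∈ Set.Icc (-(n : ℝ)) n
      · simp only [hr, hu, Set.indicator_of_mem, ← hsabs]
        ring
      · simp [hr, hu]
    have hdi : IntegrableOn (fun u => |cdf α u - cdf γ u|) (Set.Icc (-(n : ℝ)) n) :=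
      (integrable_indicator_iff measurableSet_Icc).1
        (((hmul α).sub (hmul γ)).congr (.of_forall hrabs))
    rw [integral_congr_ae (.of_forall hrabs), integral_indicator measurableSet_Icc,
      ofReal_integral_eq_lintegral_ofReal hdi (.of_forall fun u => abs_nonneg _)]
  have hcov : AECover volume Filter.atTop fun n : ℕ => Set.Icc (-(n : ℝ)) n :=
    aecover_Icc (Filter.tendsto_neg_atTop_atBot.comp tendsto_natCast_atTop_atTop)
      tendsto_natCast_atTop_atTop
  refine le_of_tendsto' (hcov.lintegral_tendsto_of_countably_generated ?_) hfin
  exact (hma.sub hmg).abs.ennreal_ofReal.aemeasurable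

/-! ### Conditionally independent copies and the reweighted law -/

section CondIIDCopy

variable {Ω 𝒳 : Type*} [MeasurableSpace Ω] [MeasurableSpace 𝒳] {P : Measure Ω}
  [IsProbabilityMeasure P] {τ : Ω → 𝒳} {T T' : Ω → ℝ}

theorem measurable_condMeanAt : Measurable (condMeanAt P τ T) :=
  (StronglyMeasurable.integral_kernel_prod_right' (κ := condDistrib T τ P)
    (f := fun p : 𝒳 × ℝ => p.2) measurable_snd.stronglyMeasurable).measurable

theorem measurable_condVarAt : Measurable (condVarAt P τ T) :=
  (StronglyMeasurable.integral_kernel_prod_right' (κ := condDistrib T τ P)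
    (f := fun p : 𝒳 × ℝ => (p.2 - condMeanAt P τ T p.1) ^ 2)
    ((measurable_snd.sub (measurable_condMeanAt.comp measurable_fst)).pow_const
      2).stronglyMeasurable).measurable

theorem lintegral_eq_lintegral_condDistrib (hτ : Measurable τ) (hT : Measurable T)
    {G : 𝒳 × ℝ → ℝ≥0∞} (hG : Measurable G) :
    ∫⁻ ω, G (τ ω, T ω) ∂P = ∫⁻ x, ∫⁻ t, G (x, t) ∂(condDistrib T τ P x) ∂(P.map τ) := by
  rw [← lintegral_map hG (hτ.prodMk hT), ← compProd_map_condDistrib hT.aemeasurable,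
    Measure.lintegral_compProd hG]

theorem integral_eq_integral_condDistrib (hτ : Measurable τ) (hT : Measurable T)
    {G : 𝒳 × ℝ → ℝ} (hG : Measurable G) (hi : Integrable (fun ω => G (τ ω, T ω)) P) :
    ∫ ω, G (τ ω, T ω) ∂P = ∫ x, ∫ t, G (x, t) ∂(condDistrib T τ P x) ∂(P.map τ) := by
  have hm : AEMeasurable (fun ω => (τ ω, T ω)) P := (hτ.prodMk hT).aemeasurable
  have hi' : Integrable G (P.map τ ⊗ₘ condDistrib T τ P) := by
    rw [compProd_map_condDistrib hT.aemeasurable]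
    exact (integrable_map_measure hG.aestronglyMeasurable hm).2 hi
  rw [← integral_map hm hG.aestronglyMeasurable, ← compProd_map_condDistrib hT.aemeasurable,
    Measure.integral_compProd hi']

theorem IsCondIIDCopy.lintegral_eq (hcopy : IsCondIIDCopy P τ T T') (hτ : Measurable τ)
    (hT : Measurable T) (hT' : Measurable T') {G : 𝒳 × ℝ × ℝ → ℝ≥0∞} (hG : Measurable G) :
    ∫⁻ ω, G (τ ω, T ω, T' ω) ∂P = ∫⁻ x, ∫⁻ t, ∫⁻ t', G (x, t, t')
      ∂(condDistrib T τ P x) ∂(condDistrib T τ P x) ∂(P.map τ) := by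
  rw [← lintegral_map hG (hτ.prodMk (hT.prodMk hT')), hcopy, Measure.lintegral_compProd hG]
  refine lintegral_congr fun x => ?_
  rw [Kernel.prod_apply, lintegral_prod _ (by fun_prop)]

theorem IsCondIIDCopy.integral_eq (hcopy : IsCondIIDCopy P τ T T') (hτ : Measurable τ)
    (hT : Measurable T) (hT' : Measurable T') {G : 𝒳 × ℝ × ℝ → ℝ} (hG : Measurable G)
    (hi : Integrable (fun ω => G (τ ω, T ω, T' ω)) P) :
    ∫ ω, G (τ ω, T ω, T' ω) ∂P = ∫ x, ∫ q, G (x, q)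
      ∂((condDistrib T τ P x).prod (condDistrib T τ P x)) ∂(P.map τ) := by
  have hm : AEMeasurable (fun ω => (τ ω, T ω, T' ω)) P :=
    (hτ.prodMk (hT.prodMk hT')).aemeasurable
  have hi' : Integrable G (P.map τ ⊗ₘ (condDistrib T τ P ×ₖ condDistrib T τ P)) := by
    rw [← hcopy]
    exact (integrable_map_measure hG.aestronglyMeasurable hm).2 hi
  rw [← integral_map hm hG.aestronglyMeasurable, hcopy, Measure.integral_compProd hi']
  simp only [Kernel.prod_apply]

theorem memLp_two_iff_lintegral_ofReal_sq {α : Type*} [MeasurableSpace α] {μ : Measure α}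
    {f : α → ℝ} (hf : AEStronglyMeasurable f μ) :
    MemLp f 2 μ ↔ ∫⁻ x, ENNReal.ofReal (f x ^ 2) ∂μ < ∞ := by
  rw [memLp_two_iff_integrable_sq hf, Integrable,
    and_iff_right (by exact hf.pow 2), hasFiniteIntegral_iff_ofReal (.of_forall fun x => sq_nonneg _)]

/-- `T` itself need not be square integrable, only `T - T' = W - W'` is. By Fubini, for almost every
`x` some fixed `t` has `t - t'` square integrable in `t'`, and subtracting from a constant is
harmless. -/
theorem IsCondIIDCopy.ae_memLp_id (hcopy : IsCondIIDCopy P τ T T') (hτ : Measurable τ)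
    (hT : Measurable T) (hT' : Measurable T') (h2 : MemLp (fun ω => T ω - T' ω) 2 P) :
    ∀ᵐ x ∂(P.map τ), MemLp (fun t : ℝ => t) 2 (condDistrib T τ P x) := by
  rw [memLp_two_iff_lintegral_ofReal_sq h2.1,
    hcopy.lintegral_eq hτ hT hT' (G := fun p => ENNReal.ofReal ((p.2.1 - p.2.2) ^ 2))
      (by fun_prop)] at h2
  have hm : Measurable fun x => ∫⁻ t, ∫⁻ t', ENNReal.ofReal ((t - t') ^ 2)
      ∂(condDistrib T τ P x) ∂(condDistrib T τ P x) := by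
    have := Measurable.lintegral_kernel_prod_right' (κ := condDistrib T τ P ×ₖ condDistrib T τ P)
      (f := fun p : 𝒳 × ℝ × ℝ => ENNReal.ofReal ((p.2.1 - p.2.2) ^ 2)) (by fun_prop)
    convert this using 2 with x
    rw [Kernel.prod_apply, lintegral_prod _ (by fun_prop)]
  filter_upwards [ae_lt_top hm h2.ne] with x hx
  obtain ⟨t, ht⟩ := (ae_lt_top (Measurable.lintegral_prod_right (by fun_prop)) hx.ne).exists
  have hmem := (memLp_two_iff_lintegral_ofReal_sq (by fun_prop)).2 ht
  refine ((memLp_const t).sub hmem).ae_eq (.of_forall fun t' => ?_)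
  simp

/-- Jensen's inequality in `t'`, obtained from nonnegativity of the variance of `t - t'`. -/
theorem sq_sub_condMeanAt_le {x : 𝒳} (hx : MemLp (fun t : ℝ => t) 2 (condDistrib T τ P x))
    (t : ℝ) : ENNReal.ofReal ((t - condMeanAt P τ T x) ^ 2) ≤
      ∫⁻ t', ENNReal.ofReal ((t - t') ^ 2) ∂(condDistrib T τ P x) := by
  have hX : MemLp (fun t' : ℝ => t - t') 2 (condDistrib T τ P x) := (memLp_const t).sub hx
  have h1 : ∫ t', (t - t') ∂(condDistrib T τ P x) = t - condMeanAt P τ T x := by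
    rw [integral_sub (integrable_const t) (hx.integrable one_le_two)]
    simp [condMeanAt]
  have h2 := variance_nonneg (fun t' : ℝ => t - t') (condDistrib T τ P x)
  rw [variance_eq_sub hX, h1] at h2
  rw [← ofReal_integral_eq_lintegral_ofReal hX.integrable_sq (.of_forall fun _ => sq_nonneg _)]
  refine ENNReal.ofReal_le_ofReal ?_
  simpa using h2

theorem lintegral_sq_sub_condMeanAt_div {x : 𝒳}
    (hx : MemLp (fun t : ℝ => t) 2 (condDistrib T τ P x)) {a : ℝ} (ha : 0 < a) :
    ∫⁻ t, ENNReal.ofReal ((t - condMeanAt P τ T x) ^ 2 / a) ∂(condDistrib T τ P x) =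
      ENNReal.ofReal (condVarAt P τ T x / a) := by
  have hX : MemLp (fun t : ℝ => t - condMeanAt P τ T x) 2 (condDistrib T τ P x) :=
    hx.sub (memLp_const _)
  rw [← ofReal_integral_eq_lintegral_ofReal (hX.integrable_sq.div_const a)
    (.of_forall fun _ => by positivity), integral_div, condVarAt]

theorem IsCondIIDCopy.memLp_sub_condMeanAt (hcopy : IsCondIIDCopy P τ T T') (hτ : Measurable τ)
    (hT : Measurable T) (hT' : Measurable T') (h2 : MemLp (fun ω => T ω - T' ω) 2 P) :
    MemLp (fun ω => T ω - condMeanAt P τ T (τ ω)) 2 P ∧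
      MemLp (fun ω => T' ω - condMeanAt P τ T (τ ω)) 2 P := by
  have hmm : Measurable (condMeanAt P τ T) := measurable_condMeanAt
  have hae := hcopy.ae_memLp_id hτ hT hT' h2
  have hle : ∫⁻ x, ∫⁻ t, ENNReal.ofReal ((t - condMeanAt P τ T x) ^ 2)
      ∂(condDistrib T τ P x) ∂(P.map τ) < ∞ := by
    refine lt_of_le_of_lt ?_ ((memLp_two_iff_lintegral_ofReal_sq h2.1).1 h2)
    rw [hcopy.lintegral_eq hτ hT hT' (G := fun p => ENNReal.ofReal ((p.2.1 - p.2.2) ^ 2))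
      (by fun_prop)]
    refine lintegral_mono_ae ?_
    filter_upwards [hae] with x hx
    exact lintegral_mono fun t => sq_sub_condMeanAt_le hx t
  constructor
  · rw [memLp_two_iff_lintegral_ofReal_sq (by fun_prop),
      lintegral_eq_lintegral_condDistrib hτ hT
        (G := fun p => ENNReal.ofReal ((p.2 - condMeanAt P τ T p.1) ^ 2)) (by fun_prop)]
    exact hle
  · rw [memLp_two_iff_lintegral_ofReal_sq (by fun_prop), hcopy.lintegral_eq hτ hT hT'
        (G := fun p => ENNReal.ofReal ((p.2.2 - condMeanAt P τ T p.1) ^ 2)) (by fun_prop)]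
    simpa using hle

theorem integral_sub_condMeanAt {x : 𝒳} (hx : MemLp (fun t : ℝ => t) 2 (condDistrib T τ P x)) :
    ∫ t, (t - condMeanAt P τ T x) ∂(condDistrib T τ P x) = 0 := by
  rw [integral_sub (hx.integrable one_le_two) (integrable_const _)]
  simp [condMeanAt]

theorem IsCondIIDCopy.integral_copy_mul_eq_zero (hcopy : IsCondIIDCopy P τ T T')
    (hτ : Measurable τ) (hT : Measurable T) (hT' : Measurable T')
    (h2 : MemLp (fun ω => T ω - T' ω) 2 P) {φ : 𝒳 × ℝ → ℝ} (hφ : Measurable φ)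
    (hi : Integrable (fun ω => φ (τ ω, T ω) * (T' ω - condMeanAt P τ T (τ ω))) P) :
    ∫ ω, φ (τ ω, T ω) * (T' ω - condMeanAt P τ T (τ ω)) ∂P = 0 := by
  have hmm : Measurable (condMeanAt P τ T) := measurable_condMeanAt
  rw [hcopy.integral_eq hτ hT hT'
    (G := fun p => φ (p.1, p.2.1) * (p.2.2 - condMeanAt P τ T p.1)) (by fun_prop) hi]
  refine integral_eq_zero_of_ae ?_
  filter_upwards [hcopy.ae_memLp_id hτ hT hT' h2] with x hx
  rw [integral_prod_mul (fun t => φ (x, t)) (fun t => t - condMeanAt P τ T x),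
    integral_sub_condMeanAt hx, mul_zero, Pi.zero_apply]

theorem IsCondIIDCopy.integral_mul_eq_zero (hcopy : IsCondIIDCopy P τ T T')
    (hτ : Measurable τ) (hT : Measurable T) (hT' : Measurable T')
    (h2 : MemLp (fun ω => T ω - T' ω) 2 P) {ψ : 𝒳 → ℝ} (hψ : Measurable ψ)
    (hi : Integrable (fun ω => ψ (τ ω) * (T ω - condMeanAt P τ T (τ ω))) P) :
    ∫ ω, ψ (τ ω) * (T ω - condMeanAt P τ T (τ ω)) ∂P = 0 := by
  have hmm : Measurable (condMeanAt P τ T) := measurable_condMeanAt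
  rw [integral_eq_integral_condDistrib hτ hT
    (G := fun p => ψ p.1 * (p.2 - condMeanAt P τ T p.1)) (by fun_prop) hi]
  refine integral_eq_zero_of_ae ?_
  filter_upwards [hcopy.ae_memLp_id hτ hT hT' h2] with x hx
  rw [integral_const_mul, integral_sub_condMeanAt hx, mul_zero, Pi.zero_apply]

/-- Replaces the conditional variance by `Y²` itself: integrals against `F^□` become expectations
under `P` weighted by `Y² / a`. -/
theorem IsCondIIDCopy.boxLaw_eq_map (hcopy : IsCondIIDCopy P τ T T')
    (hτ : Measurable τ) (hT : Measurable T) (hT' : Measurable T')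
    (h2 : MemLp (fun ω => T ω - T' ω) 2 P) {a : ℝ} (ha : 0 < a) :
    boxLaw P τ T a = (P.withDensity fun ω =>
      ENNReal.ofReal ((T ω - condMeanAt P τ T (τ ω)) ^ 2 / a)).map τ := by
  have hmm : Measurable (condMeanAt P τ T) := measurable_condMeanAt
  ext s hs
  rw [Measure.map_apply hτ hs, withDensity_apply _ (hτ hs), boxLaw, withDensity_apply _ hs,
    ← lintegral_indicator hs, ← lintegral_indicator (hτ hs)]
  have h1 : ∀ ω, (τ ⁻¹' s).indicator (fun ω =>
      ENNReal.ofReal ((T ω - condMeanAt P τ T (τ ω)) ^ 2 / a)) ω =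
      s.indicator 1 (τ ω) * ENNReal.ofReal ((T ω - condMeanAt P τ T (τ ω)) ^ 2 / a) := by
    intro ω
    by_cases h : τ ω ∈ s <;> simp [h]
  have hind : Measurable (s.indicator (1 : 𝒳 → ℝ≥0∞)) := measurable_one.indicator hs
  simp only [h1]
  rw [lintegral_eq_lintegral_condDistrib hτ hT (G := fun p => s.indicator 1 p.1 *
    ENNReal.ofReal ((p.2 - condMeanAt P τ T p.1) ^ 2 / a)) (by fun_prop)]
  refine lintegral_congr_ae ?_
  filter_upwards [hcopy.ae_memLp_id hτ hT hT' h2] with x hx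
  rw [lintegral_const_mul _ (by fun_prop), lintegral_sq_sub_condMeanAt_div hx ha]
  by_cases h : x ∈ s <;> simp [h]

end CondIIDCopy

/-! ### Moments of a Stein pair -/

section SteinPair

variable {Ω : Type*} [mΩ : MeasurableSpace Ω] {P : Measure Ω}
  {W W' : Ω → ℝ} {a : ℝ}

theorem IsSteinPair.identDistrib (h : IsSteinPair P W W' a) : IdentDistrib W W' P P := by
  refine ⟨h.measurable_left.aemeasurable, h.measurable_right.aemeasurable, ?_⟩
  have h1 := congrArg (Measure.map Prod.fst) h.exchangeable
  rwa [Measure.map_map measurable_fst (h.measurable_left.prodMk h.measurable_right),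
    Measure.map_map measurable_fst (h.measurable_right.prodMk h.measurable_left)] at h1

theorem IsSteinPair.integral_mul_right [IsProbabilityMeasure P] (h : IsSteinPair P W W' a) {φ : ℝ → ℝ}
    (hφ : Measurable φ) (hi : Integrable (fun ω => φ (W ω) * W' ω) P) :
    ∫ ω, φ (W ω) * W' ω ∂P = (1 - a) * ∫ ω, φ (W ω) * W ω ∂P := by
  have hle : MeasurableSpace.comap W inferInstance ≤ mΩ := h.measurable_left.comap_le
  have hsm : StronglyMeasurable[MeasurableSpace.comap W inferInstance] fun ω => φ (W ω) :=
    (hφ.comp (comap_measurable W)).stronglyMeasurable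
  have h1 := condExp_mul_of_stronglyMeasurable_left hsm hi h.integrable_right
  calc ∫ ω, φ (W ω) * W' ω ∂P
      = ∫ ω, (P[(fun ω => φ (W ω)) * W' | MeasurableSpace.comap W inferInstance]) ω ∂P :=
        (integral_condExp hle).symm
    _ = ∫ ω, (1 - a) * (φ (W ω) * W ω) ∂P := by
        refine integral_congr_ae ?_
        filter_upwards [h1, h.regression] with ω e1 e2
        rw [e1, Pi.mul_apply, e2]
        ring
    _ = _ := integral_const_mul _ _

theorem IsSteinPair.integral_left_eq_zero [IsProbabilityMeasure P] (h : IsSteinPair P W W' a) : ∫ ω, W ω ∂P = 0 := by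
  have h1 := h.integral_mul_right (φ := fun _ => 1) measurable_const
    (by simpa using h.integrable_right)
  simp only [one_mul] at h1
  rw [← h.identDistrib.integral_eq] at h1
  have h2 : a * ∫ ω, W ω ∂P = 0 := by linarith
  exact (mul_eq_zero.1 h2).resolve_left h.pos.ne'

theorem IsSteinPair.memLp_of_variance_eq_one [IsProbabilityMeasure P] (h : IsSteinPair P W W' a)
    (hvar : variance W P = 1) : MemLp W 2 P ∧ MemLp W' 2 P := by
  have h1 : MemLp W 2 P := memLp_two_of_variance_ne_zero
    h.measurable_left.aestronglyMeasurable (by rw [hvar]; exact one_ne_zero)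
  exact ⟨h1, h.identDistrib.memLp_iff.1 h1⟩

theorem IsSteinPair.integral_sq_eq_one [IsProbabilityMeasure P] (h : IsSteinPair P W W' a)
    (hvar : variance W P = 1) : ∫ ω, W ω * W ω ∂P = 1 := by
  rw [variance_of_integral_eq_zero h.measurable_left.aemeasurable h.integral_left_eq_zero] at hvar
  simpa [sq] using hvar

end SteinPair

theorem IsSteinPair.memLp_sub {Ω 𝒳 : Type*} [MeasurableSpace Ω] {P : Measure Ω}
    [IsProbabilityMeasure P] {τ : Ω → 𝒳} {T T' : Ω → ℝ} {V : 𝒳 → ℝ} {a : ℝ}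
    (hstein : IsSteinPair P (fun ω => V (τ ω) + T ω)
    (fun ω => V (τ ω) + T' ω) a) (hvar : variance (fun ω => V (τ ω) + T ω) P = 1) :
    MemLp (fun ω => T ω - T' ω) 2 P := by
  obtain ⟨h1, h2⟩ := hstein.memLp_of_variance_eq_one hvar
  refine (h1.sub h2).ae_eq (.of_forall fun ω => ?_)
  simp

/-! ### The Stein identity for the mixture and the main bound -/

section SteinMixture

variable {Ω 𝒳 : Type*} [MeasurableSpace Ω] [MeasurableSpace 𝒳] {P : Measure Ω}
  [IsProbabilityMeasure P] {τ : Ω → 𝒳} {T T' : Ω → ℝ} {V : 𝒳 → ℝ} {a : ℝ}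

/-- Both sides equal `E φ(W)(W - W')`: on the left by regression, on the right because `W - W' = (T
- μ_τ) - (T' - μ_τ)` and the second term is conditionally centred and independent of `W`. -/
theorem IsSteinPair.mul_integral_mul_eq (hτ : Measurable τ) (hT : Measurable T)
    (hT' : Measurable T') (hV : Measurable V) (hcopy : IsCondIIDCopy P τ T T')
    (hstein : IsSteinPair P (fun ω => V (τ ω) + T ω) (fun ω => V (τ ω) + T' ω) a)
    (hvar : variance (fun ω => V (τ ω) + T ω) P = 1) {φ : ℝ → ℝ} (hφ : Measurable φ)
    (hφ2 : MemLp (fun ω => φ (V (τ ω) + T ω)) 2 P) :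
    a * ∫ ω, φ (V (τ ω) + T ω) * (V (τ ω) + T ω) ∂P =
      ∫ ω, φ (V (τ ω) + T ω) * (T ω - condMeanAt P τ T (τ ω)) ∂P := by
  obtain ⟨hW, hW'⟩ := hstein.memLp_of_variance_eq_one hvar
  have hD := hstein.memLp_sub hvar
  obtain ⟨hY, hY'⟩ := hcopy.memLp_sub_condMeanAt hτ hT hT' hD
  have i1 := hφ2.integrable_mul hW
  have i2 := hφ2.integrable_mul hW'
  have i3 := hφ2.integrable_mul hY
  have i4 := hφ2.integrable_mul hY'
  have e1 := hstein.integral_mul_right hφ i2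
  have e2 := hcopy.integral_copy_mul_eq_zero hτ hT hT' hD (φ := fun p => φ (V p.1 + p.2))
    (by fun_prop) i4
  have e3 : ∫ ω, φ (V (τ ω) + T ω) * (V (τ ω) + T ω) ∂P -
      ∫ ω, φ (V (τ ω) + T ω) * (V (τ ω) + T' ω) ∂P =
      ∫ ω, φ (V (τ ω) + T ω) * (T ω - condMeanAt P τ T (τ ω)) ∂P -
      ∫ ω, φ (V (τ ω) + T ω) * (T' ω - condMeanAt P τ T (τ ω)) ∂P := by
    rw [← integral_sub (by exact i1) (by exact i2), ← integral_sub (by exact i3) (by exact i4)]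
    refine integral_congr_ae (.of_forall fun ω => ?_)
    ring
  simp only at e2
  linarith

/-- The identity above with `φ = id` reads `a = E W Y`; writing `W = M + Y` leaves `E Y²`, as `E M Y
= 0`. -/
theorem IsSteinPair.integral_sq_sub_condMeanAt (hτ : Measurable τ) (hT : Measurable T)
    (hT' : Measurable T') (hV : Measurable V) (hcopy : IsCondIIDCopy P τ T T')
    (hstein : IsSteinPair P (fun ω => V (τ ω) + T ω) (fun ω => V (τ ω) + T' ω) a)
    (hvar : variance (fun ω => V (τ ω) + T ω) P = 1) :
    ∫ ω, (T ω - condMeanAt P τ T (τ ω)) ^ 2 ∂P = a := by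
  have hmm : Measurable (condMeanAt P τ T) := measurable_condMeanAt
  obtain ⟨hW, hW'⟩ := hstein.memLp_of_variance_eq_one hvar
  have hD := hstein.memLp_sub hvar
  obtain ⟨hY, -⟩ := hcopy.memLp_sub_condMeanAt hτ hT hT' hD
  have hM : MemLp (fun ω => V (τ ω) + condMeanAt P τ T (τ ω)) 2 P := by
    refine (hW.sub hY).ae_eq (.of_forall fun ω => ?_)
    simp only [Pi.sub_apply]
    ring
  have e1 := hstein.mul_integral_mul_eq hτ hT hT' hV hcopy hvar measurable_id hW
  simp only [id] at e1
  rw [hstein.integral_sq_eq_one hvar, mul_one] at e1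
  have e2 := hcopy.integral_mul_eq_zero hτ hT hT' hD
    (ψ := fun x => V x + condMeanAt P τ T x) (by fun_prop) (hM.integrable_mul hY)
  rw [← add_zero (∫ ω, (T ω - condMeanAt P τ T (τ ω)) ^ 2 ∂P), ← e2,
    ← integral_add hY.integrable_sq (by exact hM.integrable_mul hY), e1]
  refine integral_congr_ae (.of_forall fun ω => ?_)
  ring

theorem IsSteinPair.evariance_sub_condMeanAt (hτ : Measurable τ) (hT : Measurable T)
    (hT' : Measurable T') (hV : Measurable V) (hcopy : IsCondIIDCopy P τ T T')
    (hstein : IsSteinPair P (fun ω => V (τ ω) + T ω) (fun ω => V (τ ω) + T' ω) a)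
    (hvar : variance (fun ω => V (τ ω) + T ω) P = 1) :
    evariance (fun ω => T ω - condMeanAt P τ T (τ ω)) P = ENNReal.ofReal a := by
  have hmm : Measurable (condMeanAt P τ T) := measurable_condMeanAt
  have hD := hstein.memLp_sub hvar
  obtain ⟨hY, -⟩ := hcopy.memLp_sub_condMeanAt hτ hT hT' hD
  have e2 := hcopy.integral_mul_eq_zero hτ hT hT' hD (ψ := fun _ => 1) measurable_const
    (by simpa using hY.integrable one_le_two)
  simp only [one_mul] at e2
  rw [← ofReal_variance hY, variance_of_integral_eq_zero (by fun_prop) e2,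
    hstein.integral_sq_sub_condMeanAt hτ hT hT' hV hcopy hvar]

theorem IsSteinPair.isProbabilityMeasure_boxLaw (hτ : Measurable τ) (hT : Measurable T)
    (hT' : Measurable T') (hV : Measurable V) (hcopy : IsCondIIDCopy P τ T T')
    (hstein : IsSteinPair P (fun ω => V (τ ω) + T ω) (fun ω => V (τ ω) + T' ω) a)
    (hvar : variance (fun ω => V (τ ω) + T ω) P = 1) :
    IsProbabilityMeasure (boxLaw P τ T a) := by
  have ha := hstein.pos
  have hD := hstein.memLp_sub hvar
  obtain ⟨hY, -⟩ := hcopy.memLp_sub_condMeanAt hτ hT hT' hD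
  constructor
  rw [hcopy.boxLaw_eq_map hτ hT hT' hD ha, Measure.map_apply hτ .univ, Set.preimage_univ,
    withDensity_apply _ .univ, Measure.restrict_univ,
    ← ofReal_integral_eq_lintegral_ofReal (hY.integrable_sq.div_const a)
      (.of_forall fun _ => by positivity), integral_div,
    hstein.integral_sq_sub_condMeanAt hτ hT hT' hV hcopy hvar, div_self ha.ne', ENNReal.ofReal_one]

theorem integrable_comp_of_lipschitz {α : Type*} [MeasurableSpace α] {μ : Measure α}
    [IsFiniteMeasure μ] {g : ℝ → ℝ} (hg : ∀ x y, |g x - g y| ≤ 2 * |x - y|) {X : α → ℝ}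
    (hX : Integrable X μ) : Integrable (fun ω => g (X ω)) μ := by
  have hgc : Continuous g := by
    refine (LipschitzWith.of_dist_le_mul (K := 2) fun x y => ?_).continuous
    simpa [Real.dist_eq] using hg x y
  refine ((hX.norm.const_mul 2).add (integrable_const |g 0|)).mono'
    (hgc.comp_aestronglyMeasurable hX.1) (.of_forall fun ω => ?_)
  have h1 := hg (X ω) 0
  rw [sub_zero] at h1
  have h2 := abs_sub_abs_le_abs_sub (g (X ω)) (g 0)
  simp only [Real.norm_eq_abs, Pi.add_apply]
  linarith

/-- The Stein equation for `W` tested against a function with `2`-Lipschitz derivative. -/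
theorem IsSteinPair.stein_discrepancy_le (hτ : Measurable τ) (hT : Measurable T)
    (hT' : Measurable T') (hV : Measurable V) (hcopy : IsCondIIDCopy P τ T T')
    (hstein : IsSteinPair P (fun ω => V (τ ω) + T ω) (fun ω => V (τ ω) + T' ω) a)
    (hvar : variance (fun ω => V (τ ω) + T ω) P = 1)
    {π : Measure (𝒳 × 𝒳)} (hπ : IsCouplingOf π (P.map τ) (boxLaw P τ T a))
    (hA : Integrable (fun p : 𝒳 × 𝒳 => (V p.2 - V p.1) +
      (condMeanAt P τ T p.2 - condMeanAt P τ T p.1)) π)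
    (hC : Integrable (fun ω => |T ω - condMeanAt P τ T (τ ω)| ^ 3) P)
    {f g : ℝ → ℝ} (hf : ∀ x, HasDerivAt f (g x) x) (hf1 : ∀ x, |f x| ≤ 1)
    (hg : ∀ x y, |g x - g y| ≤ 2 * |x - y|) :
    ∫ ω, g (V (τ ω) + T ω) ∂P - ∫ ω, f (V (τ ω) + T ω) * (V (τ ω) + T ω) ∂P ≤
      2 * (∫ p, |(V p.2 - V p.1) + (condMeanAt P τ T p.2 - condMeanAt P τ T p.1)| ∂π) +
      2 * (∫ ω, |T ω - condMeanAt P τ T (τ ω)| ∂P) +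
      (∫ ω, |T ω - condMeanAt P τ T (τ ω)| ^ 3 ∂P) / a := by
  have hprob := hstein.isProbabilityMeasure_boxLaw hτ hT hT' hV hcopy hvar
  have ha := hstein.pos
  have hD := hstein.memLp_sub hvar
  have hmm : Measurable (condMeanAt P τ T) := measurable_condMeanAt
  have hbox := hcopy.boxLaw_eq_map hτ hT hT' hD ha
  obtain ⟨hW, -⟩ := hstein.memLp_of_variance_eq_one hvar
  obtain ⟨hY, -⟩ := hcopy.memLp_sub_condMeanAt hτ hT hT' hD
  set Y : Ω → ℝ := fun ω => T ω - condMeanAt P τ T (τ ω) with hYdef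
  set M : 𝒳 → ℝ := fun x => V x + condMeanAt P τ T x with hMdef
  have hMm : Measurable M := by fun_prop
  have hWMY : ∀ ω, V (τ ω) + T ω = M (τ ω) + Y ω := fun ω => by
    simp only [hYdef, hMdef]
    ring
  have hdiff : ∀ p : 𝒳 × 𝒳, (V p.2 - V p.1) +
      (condMeanAt P τ T p.2 - condMeanAt P τ T p.1) = M p.2 - M p.1 := fun p => by
    simp only [hMdef]
    ring
  simp only [hdiff] at hA ⊢
  have hYi : Integrable Y P := hY.integrable one_le_two
  have hWi : Integrable (fun ω => V (τ ω) + T ω) P := hW.integrable one_le_two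
  have hMi : Integrable (fun ω => M (τ ω)) P := by
    refine (hWi.sub hYi).congr (.of_forall fun ω => ?_)
    simp [hWMY]
  have hfm : Measurable f :=
    (continuous_iff_continuousAt.2 fun x => (hf x).continuousAt).measurable
  have hgc : Continuous g := by
    refine (LipschitzWith.of_dist_le_mul (K := 2) fun x y => ?_).continuous
    simpa [Real.dist_eq] using hg x y
  have hgm : Measurable g := hgc.measurable
  -- transport of `M` through the coupling
  have hπp : IsProbabilityMeasure π := by
    constructor
    rw [← Measure.fst_univ, hπ.fst_eq, Measure.map_apply hτ .univ, Set.preimage_univ, measure_univ]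
  have hM1 : Integrable (fun p : 𝒳 × 𝒳 => M p.1) π := by
    have h1 : Integrable M (π.map Prod.fst) := by
      change Integrable M π.fst
      rw [hπ.fst_eq]
      exact (integrable_map_measure hMm.aestronglyMeasurable hτ.aemeasurable).2 hMi
    exact (integrable_map_measure hMm.aestronglyMeasurable measurable_fst.aemeasurable).1 h1
  -- Integrability under the second marginal is not automatic; it comes from finiteness of the
  -- coupling cost.
  have hM2 : Integrable (fun p : 𝒳 × 𝒳 => M p.2) π := by
    refine (hA.add hM1).congr (.of_forall fun p => ?_)
    simp
  have hgM1 := integrable_comp_of_lipschitz hg hM1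
  have hgM2 := integrable_comp_of_lipschitz hg hM2
  have e1 : ∫ ω, g (M (τ ω)) ∂P = ∫ p, g (M p.1) ∂π := by
    have h1 : ∫ x, g (M x) ∂(P.map τ) = ∫ x, g (M x) ∂π.fst := by rw [hπ.fst_eq]
    rwa [integral_map hτ.aemeasurable (by fun_prop), Measure.fst,
      integral_map measurable_fst.aemeasurable (by fun_prop)] at h1
  have e2 : ∫ p, g (M p.2) ∂π = ∫ x, g (M x) ∂(boxLaw P τ T a) := by
    rw [← hπ.snd_eq, Measure.snd, integral_map measurable_snd.aemeasurable (by fun_prop)]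
  have hgMbox : Integrable (fun x => g (M x)) (boxLaw P τ T a) := by
    rw [← hπ.snd_eq]
    exact (integrable_map_measure (by fun_prop) measurable_snd.aemeasurable).2 hgM2
  -- the size-biased integral as an expectation under `P`
  have hdm : Measurable fun ω => ENNReal.ofReal (Y ω ^ 2 / a) := by fun_prop
  have hdt : ∀ᵐ ω ∂P, ENNReal.ofReal (Y ω ^ 2 / a) < ∞ := .of_forall fun _ => ENNReal.ofReal_lt_top
  have htr : ∀ ω, (ENNReal.ofReal (Y ω ^ 2 / a)).toReal = Y ω ^ 2 / a := fun ω =>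
    ENNReal.toReal_ofReal (by positivity)
  have hYg : Integrable (fun ω => Y ω ^ 2 / a * g (M (τ ω))) P := by
    rw [hbox, integrable_map_measure (by fun_prop) hτ.aemeasurable,
      integrable_withDensity_iff_integrable_smul' hdm hdt] at hgMbox
    simpa only [htr, smul_eq_mul, Function.comp] using hgMbox
  have e3 : ∫ x, g (M x) ∂(boxLaw P τ T a) = ∫ ω, Y ω ^ 2 / a * g (M (τ ω)) ∂P := by
    rw [hbox, integral_map hτ.aemeasurable (by fun_prop),
      integral_withDensity_eq_integral_toReal_smul hdm hdt]
    simp only [htr, smul_eq_mul]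
  have e4 : ∫ p, g (M p.1) ∂π ≤ ∫ p, g (M p.2) ∂π + 2 * ∫ p, |M p.2 - M p.1| ∂π := by
    rw [← integral_const_mul, ← integral_add hgM2 (hA.abs.const_mul 2)]
    refine integral_mono hgM1 (hgM2.add (hA.abs.const_mul 2)) fun p => ?_
    have := (abs_le.1 (hg (M p.2) (M p.1))).1
    simp only
    linarith
  have e5 : ∫ ω, g (V (τ ω) + T ω) ∂P ≤ ∫ ω, g (M (τ ω)) ∂P + 2 * ∫ ω, |Y ω| ∂P := by
    have i1 := integrable_comp_of_lipschitz hg hMi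
    rw [← integral_const_mul, ← integral_add i1 (hYi.abs.const_mul 2)]
    refine integral_mono (integrable_comp_of_lipschitz hg hWi)
      (i1.add (hYi.abs.const_mul 2)) fun ω => ?_
    have := (abs_le.1 (hg (M (τ ω) + Y ω) (M (τ ω)))).2
    rw [add_sub_cancel_left] at this
    simp only [hWMY]
    linarith
  -- Taylor expansion of the regression term
  have hfb : ∀ X : Ω → ℝ, Measurable X → MemLp (fun ω => f (X ω)) 2 P := fun X hX =>
    MemLp.of_bound (hfm.comp hX).aestronglyMeasurable 1 (.of_forall fun ω => hf1 _)
  have e6 := hstein.mul_integral_mul_eq hτ hT hT' hV hcopy hvar hfm (hfb _ (by fun_prop))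
  have i7 : Integrable (fun ω => f (M (τ ω)) * Y ω) P :=
    (hfb _ (by fun_prop)).integrable_mul hY
  have e7 : ∫ ω, f (M (τ ω)) * Y ω ∂P = 0 :=
    hcopy.integral_mul_eq_zero hτ hT hT' hD (ψ := fun x => f (M x)) (by fun_prop) i7
  have i8 : Integrable (fun ω => f (V (τ ω) + T ω) * Y ω) P :=
    (hfb _ (by fun_prop)).integrable_mul hY
  have e8 : ∫ ω, Y ω ^ 2 / a * g (M (τ ω)) ∂P ≤
      (∫ ω, f (V (τ ω) + T ω) * Y ω ∂P) / a + (∫ ω, |Y ω| ^ 3 ∂P) / a := by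
    -- Subtracting `f(M) Y`, which has mean zero, exposes the first-order increment of `f` at `M`.
    have i9 : Integrable (fun ω => f (V (τ ω) + T ω) * Y ω - f (M (τ ω)) * Y ω) P := i8.sub i7
    have h9 : ∫ ω, f (V (τ ω) + T ω) * Y ω ∂P =
        ∫ ω, (f (V (τ ω) + T ω) * Y ω - f (M (τ ω)) * Y ω) ∂P := by
      rw [integral_sub i8 i7, e7, sub_zero]
    rw [h9, ← add_div, ← integral_add i9 hC, ← integral_div]
    refine integral_mono hYg ((i9.add hC).div_const a) fun ω => ?_
    have h10 := abs_sub_sub_mul_le_of_lipschitz_deriv hf hg (M (τ ω)) (Y ω)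
    have h11 := mul_le_mul_of_nonneg_left h10 (abs_nonneg (Y ω))
    rw [← abs_mul, ← sq_abs (Y ω)] at h11
    have h12 := (abs_le.1 h11).1
    simp only [hWMY]
    rw [div_mul_eq_mul_div]
    refine div_le_div_of_nonneg_right ?_ ha.le
    nlinarith [h12]
  have e9 : (∫ ω, f (V (τ ω) + T ω) * Y ω ∂P) / a =
      ∫ ω, f (V (τ ω) + T ω) * (V (τ ω) + T ω) ∂P := by
    rw [← e6, mul_div_cancel_left₀ _ ha.ne']
  linarith

theorem IsSteinPair.l1Dist_le (hτ : Measurable τ) (hT : Measurable T)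
    (hT' : Measurable T') (hV : Measurable V) (hcopy : IsCondIIDCopy P τ T T')
    (hstein : IsSteinPair P (fun ω => V (τ ω) + T ω) (fun ω => V (τ ω) + T' ω) a)
    (hvar : variance (fun ω => V (τ ω) + T ω) P = 1)
    {π : Measure (𝒳 × 𝒳)} (hπ : IsCouplingOf π (P.map τ) (boxLaw P τ T a)) :
    l1Dist (P.map (fun ω => V (τ ω) + T ω)) (gaussianReal 0 1) ≤
      2 * ∫⁻ p, ENNReal.ofReal
          |(V p.2 - V p.1) + (condMeanAt P τ T p.2 - condMeanAt P τ T p.1)| ∂π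
      + 2 * ∫⁻ ω, ENNReal.ofReal |T ω - condMeanAt P τ T (τ ω)| ∂P
      + (∫⁻ ω, ENNReal.ofReal (|T ω - condMeanAt P τ T (τ ω)| ^ 3) ∂P) /
          evariance (fun ω => T ω - condMeanAt P τ T (τ ω)) P := by
  have ha := hstein.pos
  have hmm : Measurable (condMeanAt P τ T) := measurable_condMeanAt
  rw [hstein.evariance_sub_condMeanAt hτ hT hT' hV hcopy hvar]
  -- If the coupling cost or the third moment is infinite, so is the right-hand side; otherwise
  -- everything reduces to real integrals.
  by_cases hAt : ∫⁻ p, ENNReal.ofReal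
      |(V p.2 - V p.1) + (condMeanAt P τ T p.2 - condMeanAt P τ T p.1)| ∂π = ∞
  · simp [hAt]
  by_cases hCt : ∫⁻ ω, ENNReal.ofReal (|T ω - condMeanAt P τ T (τ ω)| ^ 3) ∂P = ∞
  · rw [hCt, ENNReal.top_div_of_ne_top ENNReal.ofReal_ne_top, add_top]
    exact le_top
  have hA : Integrable (fun p : 𝒳 × 𝒳 => (V p.2 - V p.1) +
      (condMeanAt P τ T p.2 - condMeanAt P τ T p.1)) π :=
    ⟨by fun_prop, by
      rw [hasFiniteIntegral_iff_norm]
      exact lt_top_iff_ne_top.2 hAt⟩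
  have hC : Integrable (fun ω => |T ω - condMeanAt P τ T (τ ω)| ^ 3) P :=
    ⟨by fun_prop, by
      rw [hasFiniteIntegral_iff_ofReal (.of_forall fun _ => by positivity)]
      exact lt_top_iff_ne_top.2 hCt⟩
  have hY : Integrable (fun ω => T ω - condMeanAt P τ T (τ ω)) P :=
    (hcopy.memLp_sub_condMeanAt hτ hT hT' (hstein.memLp_sub hvar)).1.integrable one_le_two
  rw [← ofReal_integral_eq_lintegral_ofReal hA.abs (.of_forall fun _ => abs_nonneg _),
    ← ofReal_integral_eq_lintegral_ofReal hY.abs (.of_forall fun _ => abs_nonneg _),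
    ← ofReal_integral_eq_lintegral_ofReal hC (.of_forall fun _ => by positivity),
    ← ENNReal.ofReal_div_of_pos ha, ← ENNReal.ofReal_ofNat 2,
    ← ENNReal.ofReal_mul zero_le_two, ← ENNReal.ofReal_mul zero_le_two,
    ← ENNReal.ofReal_add (by positivity) (by positivity),
    ← ENNReal.ofReal_add (by positivity) (by positivity)]
  have hWm : AEMeasurable (fun ω => V (τ ω) + T ω) P := by fun_prop
  have hmap : IsProbabilityMeasure (P.map (fun ω => V (τ ω) + T ω)) :=
    Measure.isProbabilityMeasure_map hWm
  refine l1Dist_le_of_forall_lipschitz _ _ fun h B hh hB => ENNReal.ofReal_le_ofReal ?_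
  obtain ⟨f, g, hf, hf1, hg, hfg⟩ := exists_stein_solution hh hB
  refine le_trans (le_of_eq ?_)
    (hstein.stein_discrepancy_le hτ hT hT' hV hcopy hvar hπ hA hC hf hf1 hg)
  have hhc : Continuous h := by
    refine (LipschitzWith.of_dist_le_mul (K := 1) fun x y => ?_).continuous
    simpa [Real.dist_eq] using hh x y
  have hfc : Continuous f := continuous_iff_continuousAt.2 fun x => (hf x).continuousAt
  have hWi : Integrable (fun ω => V (τ ω) + T ω) P := hstein.integrable_left
  have i1 := integrable_comp_of_lipschitz hg hWi
  have i2 : Integrable (fun ω => f (V (τ ω) + T ω) * (V (τ ω) + T ω)) P :=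
    hWi.bdd_mul (c := 1) (hfc.comp_aestronglyMeasurable hWm.aestronglyMeasurable)
      (.of_forall fun ω => hf1 _)
  have i3 : Integrable (fun ω => h (V (τ ω) + T ω)) P :=
    Integrable.of_bound (hhc.comp_aestronglyMeasurable hWm.aestronglyMeasurable) B
      (.of_forall fun ω => hB _)
  rw [integral_map hWm hhc.aestronglyMeasurable, ← integral_sub i1 i2]
  have h4 : ∀ ω, g (V (τ ω) + T ω) - f (V (τ ω) + T ω) * (V (τ ω) + T ω) =
      h (V (τ ω) + T ω) - ∫ z, h z ∂(gaussianReal 0 1) := fun ω => by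
    rw [hfg]
    ring
  simp only [h4]
  rw [integral_sub i3 (integrable_const _)]
  simp

theorem boxLaw_eq_of_condVarAt_ae_const (hτ : Measurable τ)
    (hbox : IsProbabilityMeasure (boxLaw P τ T a)) {c : ℝ}
    (hc : ∀ᵐ ω ∂P, condVarAt P τ T (τ ω) = c) : boxLaw P τ T a = P.map τ := by
  have hP : IsProbabilityMeasure (P.map τ) := Measure.isProbabilityMeasure_map hτ.aemeasurable
  have h1 : ∀ᵐ x ∂(P.map τ), ENNReal.ofReal (condVarAt P τ T x / a) = ENNReal.ofReal (c / a) := by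
    have h2 : ∀ᵐ x ∂(P.map τ), condVarAt P τ T x = c :=
      (ae_map_iff hτ.aemeasurable (measurableSet_eq_fun measurable_condVarAt measurable_const)).2 hc
    filter_upwards [h2] with x hx
    rw [hx]
  have h3 : boxLaw P τ T a = ENNReal.ofReal (c / a) • P.map τ := by
    rw [boxLaw, withDensity_congr_ae h1, withDensity_const]
  -- A constant density between two probability measures must be one.
  have h4 : ENNReal.ofReal (c / a) = 1 := by
    have h5 := hbox.measure_univ
    rw [h3] at h5
    simpa using h5
  rw [h3, h4, one_smul]

end SteinMixture

theorem mainTheorem1 {Ω 𝒳 : Type*} [MeasurableSpace Ω] [MeasurableSpace 𝒳]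
    (P : Measure Ω) [IsProbabilityMeasure P]
    (τ : Ω → 𝒳) (T T' : Ω → ℝ) (V : 𝒳 → ℝ) (a : ℝ)
    (hτ : Measurable τ) (hT : Measurable T) (hT' : Measurable T') (hV : Measurable V)
    (hcopy : IsCondIIDCopy P τ T T')
    (hstein : IsSteinPair P (fun ω => V (τ ω) + T ω) (fun ω => V (τ ω) + T' ω) a)
    (hvar : variance (fun ω => V (τ ω) + T ω) P = 1) :
    IsProbabilityMeasure (boxLaw P τ T a) ∧
    (∀ π : Measure (𝒳 × 𝒳), IsCouplingOf π (P.map τ) (boxLaw P τ T a) →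
      l1Dist (P.map (fun ω => V (τ ω) + T ω)) (gaussianReal 0 1) ≤
        2 * ∫⁻ p, ENNReal.ofReal
            |(V p.2 - V p.1) + (condMeanAt P τ T p.2 - condMeanAt P τ T p.1)| ∂π
        + 2 * ∫⁻ ω, ENNReal.ofReal |T ω - condMeanAt P τ T (τ ω)| ∂P
        + (∫⁻ ω, ENNReal.ofReal (|T ω - condMeanAt P τ T (τ ω)| ^ 3) ∂P) /
            evariance (fun ω => T ω - condMeanAt P τ T (τ ω)) P) ∧
    ((∀ᵐ ω ∂P, condMeanAt P τ T (τ ω) = 0) →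
      (∃ c : ℝ, ∀ᵐ ω ∂P, condVarAt P τ T (τ ω) = c) →
      l1Dist (P.map (fun ω => V (τ ω) + T ω)) (gaussianReal 0 1) ≤
        2 * ∫⁻ ω, ENNReal.ofReal |T ω| ∂P
        + (∫⁻ ω, ENNReal.ofReal (|T ω| ^ 3) ∂P) / evariance T P) := by
  have hbox := hstein.isProbabilityMeasure_boxLaw hτ hT hT' hV hcopy hvar
  refine ⟨hbox, fun π hπ => hstein.l1Dist_le hτ hT hT' hV hcopy hvar hπ, ?_⟩
  rintro hμ ⟨c, hc⟩
  have hmm : Measurable (condMeanAt P τ T) := measurable_condMeanAt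
  have hdiag : Measurable fun x : 𝒳 => (x, x) := measurable_id.prodMk measurable_id
  -- The diagonal coupling is admissible because `F^□ = F`, and it has zero cost.
  have hπ : IsCouplingOf ((P.map τ).map fun x => (x, x)) (P.map τ) (boxLaw P τ T a) := by
    constructor
    · rw [Measure.fst, Measure.map_map measurable_fst hdiag]
      exact Measure.map_id
    · rw [Measure.snd, Measure.map_map measurable_snd hdiag,
        boxLaw_eq_of_condVarAt_ae_const hτ hbox hc]
      exact Measure.map_id
  have hTY : (fun ω => T ω - condMeanAt P τ T (τ ω)) =ᵐ[P] T := by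
    filter_upwards [hμ] with ω h
    rw [h, sub_zero]
  have h1 := hstein.l1Dist_le hτ hT hT' hV hcopy hvar hπ
  rw [lintegral_map (by fun_prop) hdiag, evariance_congr hTY,
    show ∫⁻ ω, ENNReal.ofReal |T ω - condMeanAt P τ T (τ ω)| ∂P = ∫⁻ ω, ENNReal.ofReal |T ω| ∂P from
      lintegral_congr_ae (hTY.fun_comp fun t => ENNReal.ofReal |t|),
    show ∫⁻ ω, ENNReal.ofReal (|T ω - condMeanAt P τ T (τ ω)| ^ 3) ∂P =
        ∫⁻ ω, ENNReal.ofReal (|T ω| ^ 3) ∂P from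
      lintegral_congr_ae (hTY.fun_comp fun t => ENNReal.ofReal (|t| ^ 3))] at h1
  simpa using h1
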